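/- Let $K$ be a finite extension of $\mathbb{Q}$. For $n \ge 0$ and a rational function $h = P/Q$ with $P, Q \in K[x_0,\dots,x_n]$ and $Q(0,\dots,0) \neq 0$, with Taylor expansion $h = \sum a_{i_0,\dots,i_n} x_0^{i_0}\cdots x_n^{i_n}$ at the origin, let $\Delta_n(h) = \sum_{i \ge 0} a_{i,\dots,i}\, x^i \in K[[x]]$ be its diagonal. For $f \in K[[x]]$ let $\mathbf{dg}(f)$ be the smallest $n \ge 0$ such that $f = \Delta_n(h)$ for some such $h$, and $\mathbf{dg}(f) = \infty$ if there is none (so $\mathbf{dg}(0) = 0$). For $k \ge 0$ put $$\mathcal{D}_k = \{ f \in K[[x]] : \mathbf{dg}(f) \le k \}, \qquad \mathcal{D} = \{ f \in K[[x]] : \mathbf{dg}(f) < \infty \}.$$ Let $*$ be the Hadamard product, $\left(\sum a_n x^n\right) * \left(\sum b_n x^n\right) = \sum a_n b_n x^n$. Then for all $k_1, k_2 \ge 0$, $$\mathcal{D}_{k_1} * \mathcal{D}_{k_2} \subseteq \mathcal{D}_{k_1 + k_2},$$ that is, $f_1 * f_2 \in \mathcal{D}_{k_1+k_2}$ whenever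 $f_1 \in \mathcal{D}_{k_1}$ and $f_2 \in \mathcal{D}_{k_2}$. Consequently $(\mathcal{D}, +, *)$ is a filtered ring: $\mathcal{D}$ is a $K$-subalgebra of $(K[[x]], +, *)$ (whose unit is $\sum_{n \ge 0} x^n$), and $\mathcal{D}_0 \subseteq \mathcal{D}_1 \subseteq \cdots$ is an increasing chain of $K$-subspaces with union $\mathcal{D}$, such that $\sum_{n\ge 0} x^n \in \mathcal{D}_0$ and $\mathcal{D}_{k_1} * \mathcal{D}_{k_2} \subseteq \mathcal{D}_{k_1+k_2}$. -/

import Mathlib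

namespace DiagonalGrade

open scoped PowerSeries

/-- A power series `h` in finitely many variables is (the Taylor expansion at the origin of) a
rational function `P / Q` with `Q(0, …, 0) ≠ 0`. As such a `Q` is invertible as a power series,
`Q * h = P` says exactly that `h` is the expansion of `P / Q`. -/
def IsRationalSeries {σ K : Type*} [Field K] (h : MvPowerSeries σ K) : Prop :=
  ∃ P Q : MvPolynomial σ K, MvPolynomial.constantCoeff Q ≠ 0 ∧
    (Q : MvPowerSeries σ K) * h = (P : MvPowerSeries σ K)

/-- The diagonal `Δₙ(h) = ∑ᵢ a_{i,…,i} xⁱ` of a series `h` in the `n + 1` variables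
`x₀, …, xₙ`. -/
noncomputable def diagonal {K : Type*} [Field K] (n : ℕ)
    (h : MvPowerSeries (Fin (n + 1)) K) : K⟦X⟧ :=
  PowerSeries.mk fun i =>
    MvPowerSeries.coeff (Finsupp.equivFunOnFinite.symm fun _ : Fin (n + 1) => i) h

/-- `f` is the diagonal of a rational function in the `n + 1` variables `x₀, …, xₙ`. -/
def IsDiagonal {K : Type*} [Field K] (n : ℕ) (f : K⟦X⟧) : Prop :=
  ∃ h : MvPowerSeries (Fin (n + 1)) K, IsRationalSeries h ∧ diagonal n h = f

/-- The diagonal grade: the smallest `n` such that `f` is the diagonal of a rational function in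
`x₀, …, xₙ`, and `⊤` if there is none. The zero series gets grade `0`. -/
noncomputable def dg {K : Type*} [Field K] (f : K⟦X⟧) : ℕ∞ :=
  ⨅ (n : ℕ) (_ : IsDiagonal n f), (n : ℕ∞)

/-- `𝓓ₖ`, the series of diagonal grade at most `k`. -/
def diagonalsLE (K : Type*) [Field K] (k : ℕ) : Set K⟦X⟧ := {f | dg f ≤ k}

/-- `𝓓`, the series of finite diagonal grade. -/
def diagonals (K : Type*) [Field K] : Set K⟦X⟧ := {f | dg f < ⊤}

/-- The Hadamard product `(∑ aₙ xⁿ) * (∑ bₙ xⁿ) = ∑ aₙ bₙ xⁿ`. -/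
noncomputable def hadamard {K : Type*} [Field K] (f g : K⟦X⟧) : K⟦X⟧ :=
  PowerSeries.mk fun n => PowerSeries.coeff n f * PowerSeries.coeff n g

/-- The `K`-vector space `K⟦X⟧`, to be equipped with the Hadamard product as multiplication. -/
def HadamardSeries (K : Type*) [Field K] : Type _ := K⟦X⟧

namespace HadamardSeries

variable {K : Type*} [Field K]

noncomputable instance : AddCommGroup (HadamardSeries K) := inferInstanceAs (AddCommGroup K⟦X⟧)

noncomputable instance : Module K (HadamardSeries K) := inferInstanceAs (Module K K⟦X⟧)

/-- The identity map, as a `K`-linear equivalence. -/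
noncomputable def of : K⟦X⟧ ≃ₗ[K] HadamardSeries K := LinearEquiv.refl K K⟦X⟧

noncomputable instance : Mul (HadamardSeries K) :=
  ⟨fun a b => of (hadamard (of.symm a) (of.symm b))⟩

/-- The unit for the Hadamard product is `∑ xⁿ = 1 / (1 - x)`. -/
noncomputable instance : One (HadamardSeries K) := ⟨of (PowerSeries.mk fun _ => 1)⟩

theorem of_symm_mul (a b : HadamardSeries K) :
    of.symm (a * b) = hadamard (of.symm a) (of.symm b) := rfl

theorem of_symm_one : of.symm (1 : HadamardSeries K) = PowerSeries.mk fun _ => 1 := rfl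

theorem ext_coeff {a b : HadamardSeries K}
    (h : ∀ n, PowerSeries.coeff n (of.symm a) = PowerSeries.coeff n (of.symm b)) : a = b :=
  of.symm.injective (PowerSeries.ext h)

theorem coeff_mul (n : ℕ) (a b : HadamardSeries K) :
    PowerSeries.coeff n (of.symm (a * b)) =
      PowerSeries.coeff n (of.symm a) * PowerSeries.coeff n (of.symm b) := by
  rw [of_symm_mul, hadamard, PowerSeries.coeff_mk]

theorem coeff_one (n : ℕ) : PowerSeries.coeff n (of.symm (1 : HadamardSeries K)) = 1 := by
  rw [of_symm_one, PowerSeries.coeff_mk]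

noncomputable instance : CommRing (HadamardSeries K) where
  __ := (inferInstance : AddCommGroup (HadamardSeries K))
  __ := (inferInstance : Mul (HadamardSeries K))
  __ := (inferInstance : One (HadamardSeries K))
  left_distrib a b c := ext_coeff fun n => by simp only [coeff_mul, map_add, mul_add]
  right_distrib a b c := ext_coeff fun n => by simp only [coeff_mul, map_add, add_mul]
  zero_mul a := ext_coeff fun n => by simp only [coeff_mul, map_zero, zero_mul]
  mul_zero a := ext_coeff fun n => by simp only [coeff_mul, map_zero, mul_zero]
  mul_assoc a b c := ext_coeff fun n => by simp only [coeff_mul, mul_assoc]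
  one_mul a := ext_coeff fun n => by simp only [coeff_mul, coeff_one, one_mul]
  mul_one a := ext_coeff fun n => by simp only [coeff_mul, coeff_one, mul_one]
  mul_comm a b := ext_coeff fun n => by simp only [coeff_mul, mul_comm]

noncomputable instance : Algebra K (HadamardSeries K) :=
  Algebra.ofModule
    (fun c a b => ext_coeff fun n => by
      simp only [coeff_mul, map_smul, smul_eq_mul, mul_assoc])
    (fun c a b => ext_coeff fun n => by
      simp only [coeff_mul, map_smul, smul_eq_mul, mul_left_comm])

end HadamardSeries

end DiagonalGrade

/-! Expand a rational series in its first variable as `∑ sᵢ x₀ⁱ`, where each `sᵢ` is a rational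
series in the other variables. The `i`-th diagonal coefficient is then the coefficient of `sᵢ` at
`(i, …, i)`. Given a second series `∑ tᵢ x₀ⁱ`, share `x₀`, place the remaining variables in disjoint
blocks `y`, `z`, and form `∑ sᵢ(y) tᵢ(z) x₀ⁱ`. It has `m + n + 1` variables, and its diagonal is the
Hadamard product of the two diagonals.

It remains to see that this series is rational (`IsRational.hadamard`). Over any commutative ring,
rationality in one variable means that the coefficients satisfy a monic linear recurrence, i.e. lie
in a finitely generated shift-stable module of sequences. A product of two such modules is again
one. The coefficient ring used is that of rational series regular at the origin, so denominators
stay invertible there (`isRationalSeries_iff_exists_slices`). -/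

namespace DiagonalGrade

open scoped PowerSeries Polynomial

/-! ### Linear recurrences and rational series over a commutative ring -/

section Recurrence

variable {A : Type*} [CommRing A]

/-- The shift operator `(uₙ) ↦ (uₙ₊₁)` on sequences. -/
def shift (A : Type*) [CommRing A] : Module.End A (ℕ → A) where
  toFun u n := u (n + 1)
  map_add' _ _ := rfl
  map_smul' _ _ := rfl

theorem shift_apply (u : ℕ → A) (n : ℕ) : shift A u n = u (n + 1) := rfl

theorem shift_mul (u v : ℕ → A) : shift A (u * v) = shift A u * shift A v := rfl

theorem shift_pow_apply (i : ℕ) (u : ℕ → A) (n : ℕ) : (shift A ^ i) u n = u (n + i) := by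
  induction i generalizing n with
  | zero => rfl
  | succ i ih => rw [pow_succ', Module.End.mul_apply, shift_apply, ih, add_right_comm, add_assoc]

/-- The sequence `u` satisfies a linear recurrence with constant coefficients and monic
characteristic polynomial. -/
def IsLinearRecurrent (u : ℕ → A) : Prop :=
  ∃ p : A[X], p.Monic ∧ Polynomial.aeval (shift A) p u = 0

theorem isLinearRecurrent_iff_exists_fg {u : ℕ → A} :
    IsLinearRecurrent u ↔
      ∃ M : Submodule A (ℕ → A), M.FG ∧ (∀ v ∈ M, shift A v ∈ M) ∧ u ∈ M := by
  constructor
  · rintro ⟨p, hp, hu⟩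
    let L : A[X] →ₗ[A] (ℕ → A) :=
      (LinearMap.applyₗ u).comp (Polynomial.aeval (shift A)).toLinearMap
    have hL : ∀ f, L f = Polynomial.aeval (shift A) f u := fun f => rfl
    -- Since `p` kills `u`, division by the monic `p` leaves only remainders of degree less than
    -- `p.natDegree`.
    have hmod : ∀ f, L f ∈ (Polynomial.degreeLT A p.natDegree).map L := by
      intro f
      nontriviality A
      refine ⟨f %ₘ p, Polynomial.mem_degreeLT.2 ?_, ?_⟩
      · rw [← Polynomial.degree_eq_natDegree hp.ne_zero]
        exact Polynomial.degree_modByMonic_lt f hp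
      · conv_rhs => rw [← Polynomial.modByMonic_add_div f p]
        rw [map_add, hL (p * _), mul_comm p, map_mul, Module.End.mul_apply, hu, map_zero, add_zero]
    refine ⟨(Polynomial.degreeLT A p.natDegree).map L, ?_, ?_, ?_⟩
    · exact Submodule.FG.map L (Module.Finite.iff_fg.1
        (Module.Finite.equiv (Polynomial.degreeLTEquiv A p.natDegree).symm))
    · rintro _ ⟨f, -, rfl⟩
      have : shift A (L f) = L (Polynomial.X * f) := by
        rw [hL, hL, map_mul, Polynomial.aeval_X, Module.End.mul_apply]
      rw [this]
      exact hmod _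
    · have : u = L 1 := by rw [hL, map_one, Module.End.one_apply]
      rw [this]
      exact hmod _
  · rintro ⟨M, hfg, hM, hu⟩
    have : Module.Finite A M := Module.Finite.iff_fg.2 hfg
    -- Cayley–Hamilton for an endomorphism of a finitely generated module.
    obtain ⟨p, hp, h0⟩ := LinearMap.exists_monic_and_aeval_eq_zero A ((shift A).restrict hM)
    refine ⟨p, hp, ?_⟩
    have key : ∀ v : M, Polynomial.aeval (shift A) p v =
        (Polynomial.aeval ((shift A).restrict hM) p v : M) := by
      intro v
      have hpow : ∀ (i : ℕ) (v : M), (shift A ^ i) v = (((shift A).restrict hM ^ i) v : M) := by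
        intro i
        induction i with
        | zero => intro v; rfl
        | succ i ih =>
          intro v
          rw [pow_succ, pow_succ, Module.End.mul_apply, Module.End.mul_apply, ← ih]
          rfl
      rw [Polynomial.aeval_eq_sum_range, Polynomial.aeval_eq_sum_range, LinearMap.sum_apply,
        LinearMap.sum_apply, Submodule.coe_sum]
      exact Finset.sum_congr rfl fun i _ => by
        rw [LinearMap.smul_apply, LinearMap.smul_apply, Submodule.coe_smul, hpow]
    have := key ⟨u, hu⟩
    rwa [h0, LinearMap.zero_apply, Submodule.coe_zero] at this

theorem IsLinearRecurrent.mul {u v : ℕ → A} (hu : IsLinearRecurrent u)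
    (hv : IsLinearRecurrent v) : IsLinearRecurrent (u * v) := by
  rw [isLinearRecurrent_iff_exists_fg] at *
  obtain ⟨M, hM, hMs, huM⟩ := hu
  obtain ⟨N, hN, hNs, hvN⟩ := hv
  refine ⟨M * N, hM.mul hN, fun w hw => ?_, Submodule.mul_mem_mul huM hvN⟩
  induction hw using Submodule.mul_induction_on' with
  | mem_mul_mem m hm n hn =>
    rw [shift_mul]
    exact Submodule.mul_mem_mul (hMs m hm) (hNs n hn)
  | add x _ y _ hx hy =>
    rw [map_add]
    exact add_mem hx hy

/-- Reversing `p` turns the recurrence into a Cauchy product, so `p` annihilates `u` exactly when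
the reversed polynomial times the generating series has no terms from degree `N` on. `N` is left
free because a numerator may have larger degree than its denominator. -/
theorem aeval_shift_apply {p : A[X]} {N : ℕ} (hp : p.natDegree ≤ N) (u : ℕ → A) (n : ℕ) :
    Polynomial.aeval (shift A) p u n =
      PowerSeries.coeff (n + N) ((p.reflect N : A[X]) * PowerSeries.mk u : A⟦X⟧) := by
  rw [Polynomial.aeval_eq_sum_range' (Nat.lt_succ_of_le hp), LinearMap.sum_apply,
    Finset.sum_apply, ← Finset.sum_range_reflect, PowerSeries.coeff_mul,
    Finset.Nat.sum_antidiagonal_eq_sum_range_succ (fun i j =>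
      PowerSeries.coeff i ((p.reflect N : A[X]) : A⟦X⟧) * PowerSeries.coeff j (PowerSeries.mk u))]
  -- The Cauchy product has extra terms `i > N`; reflection fixes those indices, where `p` has zero
  -- coefficients.
  refine Finset.sum_subset_zero_on_sdiff (Finset.range_mono (by omega)) ?_ ?_
  · intro i hi
    have hi' : N < i := by
      simpa using (Finset.mem_sdiff.1 hi).2
    rw [Polynomial.coeff_coe, Polynomial.coeff_reflect, Polynomial.revAt_eq_self_of_lt hi',
      Polynomial.coeff_eq_zero_of_natDegree_lt (hp.trans_lt hi'), zero_mul]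
  · intro i hi
    have hi' : i ≤ N := by simpa [Nat.lt_succ_iff] using hi
    rw [Polynomial.coeff_coe, Polynomial.coeff_reflect, Polynomial.revAt_le hi',
      PowerSeries.coeff_mk, LinearMap.smul_apply, Pi.smul_apply, shift_pow_apply, smul_eq_mul,
      Nat.succ_sub_one, Nat.add_sub_assoc hi']

/-- A power series over a commutative ring is rational if it is a quotient `p / q` of polynomials
where `q` has invertible constant term. -/
def IsRational (f : A⟦X⟧) : Prop :=
  ∃ p q : A[X], IsUnit (q.coeff 0) ∧ (q : A⟦X⟧) * f = p

theorem isRational_iff_isLinearRecurrent {f : A⟦X⟧} :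
    IsRational f ↔ IsLinearRecurrent fun n => PowerSeries.coeff n f := by
  have hf : PowerSeries.mk (fun n => PowerSeries.coeff n f) = f := by ext; simp
  constructor
  · rintro ⟨p, q, ⟨c, hc⟩, h⟩
    -- `N` bounds the degree of `q` and strictly exceeds that of `p`, so the numerator vanishes from
    -- degree `N` on. Scaling `q` to constant term `1` makes its reflection monic.
    set N := max q.natDegree p.natDegree + 1 with hN
    set r : A[X] := Polynomial.C (↑c⁻¹ : A) * q with hr
    have hrN : r.natDegree ≤ N := (Polynomial.natDegree_C_mul_le _ _).trans (by omega)
    have hdeg : (r.reflect N).natDegree ≤ N :=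
      Polynomial.natDegree_reflect_le.trans (by omega)
    refine ⟨r.reflect N, Polynomial.monic_of_natDegree_le_of_coeff_eq_one N hdeg ?_, ?_⟩
    · rw [Polynomial.coeff_reflect, Polynomial.revAt_le le_rfl, Nat.sub_self, hr,
        Polynomial.coeff_C_mul, ← hc, Units.inv_mul]
    · ext n
      rw [aeval_shift_apply hdeg, Polynomial.reflect_reflect, hf, hr, Polynomial.coe_mul, mul_assoc,
        h, Polynomial.coe_C, PowerSeries.coeff_C_mul, Polynomial.coeff_coe,
        Polynomial.coeff_eq_zero_of_natDegree_lt (by omega), mul_zero, Pi.zero_apply]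
  · rintro ⟨p, hp, h⟩
    -- The recurrence kills all coefficients of the product from `p.natDegree` on, so truncation
    -- loses nothing.
    refine ⟨PowerSeries.trunc p.natDegree ((p.reflect p.natDegree : A[X]) * f),
      p.reflect p.natDegree, ?_, ?_⟩
    · rw [Polynomial.coeff_reflect, Polynomial.revAt_zero, hp.coeff_natDegree]
      exact isUnit_one
    · ext n
      rw [Polynomial.coeff_coe, PowerSeries.coeff_trunc]
      split_ifs with hn
      · rfl
      · obtain ⟨m, rfl⟩ := Nat.exists_eq_add_of_le' (not_lt.1 hn)
        have := aeval_shift_apply (le_refl p.natDegree) (fun n => PowerSeries.coeff n f) m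
        rw [h, hf] at this
        exact this.symm

/-- Rational power series are closed under coefficientwise products. -/
theorem IsRational.hadamard {f g : A⟦X⟧} (hf : IsRational f) (hg : IsRational g) :
    IsRational (PowerSeries.mk fun n => PowerSeries.coeff n f * PowerSeries.coeff n g) := by
  rw [isRational_iff_isLinearRecurrent] at *
  simp only [PowerSeries.coeff_mk]
  exact hf.mul hg

theorem IsRational.map {B : Type*} [CommRing B] (φ : A →+* B) {f : A⟦X⟧} (hf : IsRational f) :
    IsRational (PowerSeries.map φ f) := by
  obtain ⟨p, q, hq, h⟩ := hf
  refine ⟨p.map φ, q.map φ, ?_, ?_⟩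
  · rw [Polynomial.coeff_map]
    exact hq.map φ
  · rw [Polynomial.polynomial_map_coe, Polynomial.polynomial_map_coe, ← map_mul, h]

theorem isRational_mk_const (a : A) : IsRational (PowerSeries.mk fun _ => a) := by
  rw [isRational_iff_isLinearRecurrent]
  refine ⟨Polynomial.X - Polynomial.C 1, Polynomial.monic_X_sub_C 1, ?_⟩
  ext n
  simp [shift_apply]

end Recurrence

/-! ### The ring of rational series regular at the origin -/

section RationalSeries

variable {σ τ K : Type*} [Field K]

theorem constantCoeff_coe_mvPolynomial (P : MvPolynomial σ K) :
    MvPowerSeries.constantCoeff (P : MvPowerSeries σ K) = MvPolynomial.constantCoeff P := by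
  rw [← MvPowerSeries.coeff_zero_eq_constantCoeff_apply, MvPolynomial.coeff_coe,
    MvPolynomial.constantCoeff_eq]

/-- If `Q q = P` and `Q' q h = P'`, then `(Q' P) h = P' Q`, and `P(0) = Q(0) q(0) ≠ 0`. -/
theorem IsRationalSeries.of_mul {q h : MvPowerSeries σ K} (hq : IsRationalSeries q)
    (hq0 : MvPowerSeries.constantCoeff q ≠ 0) (hqh : IsRationalSeries (q * h)) :
    IsRationalSeries h := by
  obtain ⟨P, Q, hQ, h1⟩ := hq
  obtain ⟨P', Q', hQ', h2⟩ := hqh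
  refine ⟨P' * Q, Q' * P, ?_, ?_⟩
  · rw [map_mul, ← constantCoeff_coe_mvPolynomial P, ← h1, map_mul,
      constantCoeff_coe_mvPolynomial]
    exact mul_ne_zero hQ' (mul_ne_zero hQ hq0)
  · rw [MvPolynomial.coe_mul, MvPolynomial.coe_mul, ← h1, ← h2]
    ring

theorem isRationalSeries_coe (P : MvPolynomial σ K) :
    IsRationalSeries (P : MvPowerSeries σ K) :=
  ⟨P, 1, by simp, by simp⟩

/-- The algebra of power series expansions of rational functions. -/
def rationalSeries (σ K : Type*) [Field K] : Subalgebra K (MvPowerSeries σ K) where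
  carrier := {h | IsRationalSeries h}
  mul_mem' := by
    rintro a b ⟨P, Q, hQ, h⟩ ⟨P', Q', hQ', h'⟩
    refine ⟨P * P', Q * Q', by simpa using ⟨hQ, hQ'⟩, ?_⟩
    rw [MvPolynomial.coe_mul, MvPolynomial.coe_mul, ← h, ← h']
    ring
  add_mem' := by
    rintro a b ⟨P, Q, hQ, h⟩ ⟨P', Q', hQ', h'⟩
    refine ⟨P * Q' + Q * P', Q * Q', by simpa using ⟨hQ, hQ'⟩, ?_⟩
    rw [MvPolynomial.coe_add, MvPolynomial.coe_mul, MvPolynomial.coe_mul, MvPolynomial.coe_mul,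
      ← h, ← h']
    ring
  algebraMap_mem' r := by
    have : algebraMap K (MvPowerSeries σ K) r = (MvPolynomial.C r : MvPolynomial σ K) := by
      rw [MvPolynomial.coe_C]
      rfl
    rw [this]
    exact isRationalSeries_coe _

theorem IsRationalSeries.rename (e : σ ↪ τ) {h : MvPowerSeries σ K} (hh : IsRationalSeries h) :
    IsRationalSeries (MvPowerSeries.rename e h) := by
  obtain ⟨P, Q, hQ, h⟩ := hh
  refine ⟨MvPolynomial.rename e P, MvPolynomial.rename e Q, ?_, ?_⟩
  · rwa [MvPolynomial.constantCoeff_rename]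
  · rw [← MvPowerSeries.rename_coe, ← MvPowerSeries.rename_coe, ← map_mul, h]

/-- Renaming the variables of rational series along an embedding. -/
noncomputable def renameRational (K : Type*) [Field K] (e : σ ↪ τ) :
    rationalSeries σ K →+* rationalSeries τ K :=
  ((MvPowerSeries.rename e : MvPowerSeries σ K →ₐ[K] MvPowerSeries τ K).toRingHom.comp
    (rationalSeries σ K).val.toRingHom).codRestrict (rationalSeries τ K)
    fun h => IsRationalSeries.rename e h.2

theorem coe_renameRational (e : σ ↪ τ) (h : rationalSeries σ K) :
    (renameRational K e h : MvPowerSeries τ K) = MvPowerSeries.rename e (h : MvPowerSeries σ K) :=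
  rfl

theorem isUnit_rationalSeries_iff {h : rationalSeries σ K} :
    IsUnit h ↔ MvPowerSeries.constantCoeff (h : MvPowerSeries σ K) ≠ 0 := by
  constructor
  · intro hu
    exact ((hu.map (rationalSeries σ K).val).map
      (MvPowerSeries.constantCoeff (σ := σ) (R := K))).ne_zero
  · intro h0
    have hmul : (h : MvPowerSeries σ K) * (h : MvPowerSeries σ K)⁻¹ = 1 :=
      MvPowerSeries.mul_inv_cancel _ h0
    refine IsUnit.of_mul_eq_one ⟨(h : MvPowerSeries σ K)⁻¹, IsRationalSeries.of_mul h.2 h0 ?_⟩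
      (Subtype.ext hmul)
    rw [hmul]
    exact one_mem (rationalSeries σ K)

/-- If the ranges of `e₁` and `e₂` are disjoint, the product of a series in the variables `e₁` with
one in the variables `e₂` has as coefficients the products of coefficients. -/
theorem coeff_rename_mul_rename {σ₁ σ₂ : Type*} (e₁ : σ₁ ↪ τ) (e₂ : σ₂ ↪ τ)
    (hd : ∀ i j, e₁ i ≠ e₂ j) (a : MvPowerSeries σ₁ K) (b : MvPowerSeries σ₂ K)
    (m₁ : σ₁ →₀ ℕ) (m₂ : σ₂ →₀ ℕ) :
    MvPowerSeries.coeff (m₁.embDomain e₁ + m₂.embDomain e₂)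
        (MvPowerSeries.rename e₁ a * MvPowerSeries.rename e₂ b) =
      MvPowerSeries.coeff m₁ a * MvPowerSeries.coeff m₂ b := by
  classical
  rw [MvPowerSeries.coeff_mul, Finset.sum_eq_single (m₁.embDomain e₁, m₂.embDomain e₂)]
  · rw [MvPowerSeries.coeff_embDomain_rename, MvPowerSeries.coeff_embDomain_rename]
  · rintro ⟨x, y⟩ hxy hne
    rw [Finset.HasAntidiagonal.mem_antidiagonal] at hxy
    by_cases hx : x ∈ Set.range (Finsupp.mapDomain e₁)
    swap
    · rw [MvPowerSeries.coeff_rename_eq_zero _ _ hx, zero_mul]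
    by_cases hy : y ∈ Set.range (Finsupp.mapDomain e₂)
    swap
    · rw [MvPowerSeries.coeff_rename_eq_zero _ _ hy, mul_zero]
    obtain ⟨x, rfl⟩ := hx
    obtain ⟨y, rfl⟩ := hy
    simp only [← Finsupp.embDomain_eq_mapDomain] at hxy hne
    refine absurd ?_ hne
    -- At `e₁ i` the summands supported on the range of `e₂` vanish.
    have hx : x = m₁ := by
      ext i
      have hi : e₁ i ∉ Set.range e₂ := by
        rintro ⟨j, hj⟩
        exact hd i j hj.symm
      simpa [Finsupp.embDomain_of_notMem_range _ _ _ hi] using DFunLike.congr_fun hxy (e₁ i)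
    subst hx
    rw [add_left_cancel hxy]
  · intro h
    refine absurd ?_ h
    rw [Finset.HasAntidiagonal.mem_antidiagonal]

end RationalSeries

/-! ### Slicing along the first variable -/

section Slices

variable {K : Type*} [Field K] {n : ℕ}

theorem finSuccEquiv_coe (P : MvPolynomial (Fin (n + 1)) K) :
    MvPowerSeries.finSuccEquiv K n (P : MvPowerSeries (Fin (n + 1)) K) =
      PowerSeries.mk fun i => (((MvPolynomial.finSuccEquiv K n P).coeff i :
        MvPolynomial (Fin n) K) : MvPowerSeries (Fin n) K) := by
  ext i m
  rw [MvPowerSeries.coeff_coeff_finSuccEquiv, PowerSeries.coeff_mk, MvPolynomial.coeff_coe,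
    MvPolynomial.coeff_coe, MvPolynomial.finSuccEquiv_coeff_coeff]

theorem finSuccEquiv_rename_succ (a : MvPowerSeries (Fin n) K) :
    MvPowerSeries.finSuccEquiv K n (MvPowerSeries.rename (Fin.succEmb n) a) =
      PowerSeries.C a := by
  ext i m
  rw [MvPowerSeries.coeff_coeff_finSuccEquiv, PowerSeries.coeff_C]
  split_ifs with hi
  · subst hi
    have : m.cons 0 = m.embDomain (Fin.succEmb n) := by
      ext j
      refine Fin.cases ?_ (fun j => ?_) j
      · rw [Finsupp.cons_zero, Finsupp.embDomain_of_notMem_range]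
        rintro ⟨j, hj⟩
        exact Fin.succ_ne_zero j hj
      · rw [Finsupp.cons_succ]
        exact (Finsupp.embDomain_apply_self (Fin.succEmb n) m j).symm
    rw [this, MvPowerSeries.coeff_embDomain_rename]
  · rw [map_zero]
    refine MvPowerSeries.coeff_rename_eq_zero _ _ ?_
    rintro ⟨x, hx⟩
    refine hi ?_
    have := DFunLike.congr_fun hx 0
    rw [← Finsupp.embDomain_eq_mapDomain, Finsupp.cons_zero,
      Finsupp.embDomain_of_notMem_range] at this
    · exact this.symm
    · rintro ⟨j, hj⟩
      exact Fin.succ_ne_zero j hj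

/-- Rational series in `n` variables, as coefficients. -/
noncomputable def rationalVal (K : Type*) [Field K] (n : ℕ) :
    rationalSeries (Fin n) K →+* MvPowerSeries (Fin n) K :=
  (rationalSeries (Fin n) K).val.toRingHom

theorem rationalVal_apply (a : rationalSeries (Fin n) K) :
    rationalVal K n a = (a : MvPowerSeries (Fin n) K) := rfl

/-- The series in `n + 1` variables with given slices in the first variable. -/
noncomputable def ofSlices (K : Type*) [Field K] (n : ℕ) :
    (rationalSeries (Fin n) K)⟦X⟧ →+* MvPowerSeries (Fin (n + 1)) K :=
  ((MvPowerSeries.finSuccEquiv K n).symm : _ →+* MvPowerSeries (Fin (n + 1)) K).comp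
    (PowerSeries.map (rationalVal K n))

theorem coeff_cons_ofSlices (f : (rationalSeries (Fin n) K)⟦X⟧) (i : ℕ) (m : Fin n →₀ ℕ) :
    MvPowerSeries.coeff (m.cons i) (ofSlices K n f) =
      MvPowerSeries.coeff m
        ((PowerSeries.coeff i f : rationalSeries (Fin n) K) : MvPowerSeries (Fin n) K) := by
  rw [← MvPowerSeries.coeff_coeff_finSuccEquiv, ofSlices, RingHom.comp_apply, RingHom.coe_coe,
    AlgEquiv.apply_symm_apply, PowerSeries.coeff_map, rationalVal_apply]

theorem isRationalSeries_ofSlices_coe (p : (rationalSeries (Fin n) K)[X]) :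
    IsRationalSeries (ofSlices K n p) := by
  induction p using Polynomial.induction_on' with
  | add p q hp hq =>
    rw [Polynomial.coe_add, map_add]
    exact (rationalSeries _ K).add_mem hp hq
  | monomial i a =>
    rw [← Polynomial.C_mul_X_pow_eq_monomial, Polynomial.coe_mul, Polynomial.coe_pow,
      Polynomial.coe_C, Polynomial.coe_X, map_mul, map_pow]
    refine (rationalSeries _ K).mul_mem ?_ ((rationalSeries _ K).pow_mem ?_ i)
    · have : ofSlices K n (PowerSeries.C a) =
          MvPowerSeries.rename (Fin.succEmb n) (a : MvPowerSeries (Fin n) K) := by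
        rw [← (MvPowerSeries.finSuccEquiv K n).symm_apply_apply (MvPowerSeries.rename _ _),
          finSuccEquiv_rename_succ, ofSlices, RingHom.comp_apply, PowerSeries.map_C]
        rfl
      rw [this]
      exact IsRationalSeries.rename _ a.2
    · have : ofSlices K n PowerSeries.X = (MvPolynomial.X 0 : MvPolynomial (Fin (n + 1)) K) := by
        rw [MvPolynomial.coe_X, ← (MvPowerSeries.finSuccEquiv K n).symm_apply_apply
          (MvPowerSeries.X 0), MvPowerSeries.finSuccEquiv_X_zero, ofSlices, RingHom.comp_apply,
          PowerSeries.map_X]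
        rfl
      rw [this]
      exact isRationalSeries_coe _

/-- A series in `n + 1` variables is rational if and only if its slices in the first variable are
rational and form a rational power series in that variable. -/
theorem isRationalSeries_iff_exists_slices {h : MvPowerSeries (Fin (n + 1)) K} :
    IsRationalSeries h ↔
      ∃ f : (rationalSeries (Fin n) K)⟦X⟧, IsRational f ∧ ofSlices K n f = h := by
  constructor
  · rintro ⟨P, Q, hQ, hPQ⟩
    let ι : MvPolynomial (Fin n) K →+* rationalSeries (Fin n) K :=
      (MvPolynomial.coeToMvPowerSeries.ringHom).codRestrict (rationalSeries (Fin n) K)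
        isRationalSeries_coe
    have hι : ∀ R : MvPolynomial (Fin (n + 1)) K,
        ofSlices K n (((MvPolynomial.finSuccEquiv K n R).map ι : (rationalSeries (Fin n) K)[X])) =
          (R : MvPowerSeries (Fin (n + 1)) K) := by
      intro R
      apply (MvPowerSeries.finSuccEquiv K n).injective
      rw [finSuccEquiv_coe, ofSlices, RingHom.comp_apply, RingHom.coe_coe,
        AlgEquiv.apply_symm_apply]
      ext i : 1
      rw [PowerSeries.coeff_map, Polynomial.coeff_coe, Polynomial.coeff_map, PowerSeries.coeff_mk]
      rfl
    set q := (MvPolynomial.finSuccEquiv K n Q).map ι with hq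
    have hq0 : IsUnit (q.coeff 0) := by
      rw [isUnit_rationalSeries_iff, hq, Polynomial.coeff_map]
      change MvPowerSeries.constantCoeff
        (((MvPolynomial.finSuccEquiv K n Q).coeff 0 : MvPolynomial (Fin n) K) :
          MvPowerSeries (Fin n) K) ≠ 0
      rwa [constantCoeff_coe_mvPolynomial, MvPolynomial.constantCoeff_eq,
        MvPolynomial.finSuccEquiv_coeff_coeff, Finsupp.cons_zero_zero,
        ← MvPolynomial.constantCoeff_eq]
    have hqu : IsUnit (q : (rationalSeries (Fin n) K)⟦X⟧) := by
      rw [PowerSeries.isUnit_iff_constantCoeff, ← PowerSeries.coeff_zero_eq_constantCoeff_apply,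
        Polynomial.coeff_coe]
      exact hq0
    -- The slices are those of `P / Q`, computed in power series over the ring of rational series,
    -- where `q` is a unit.
    obtain ⟨c, hc⟩ := hqu
    refine ⟨↑c⁻¹ * ((MvPolynomial.finSuccEquiv K n P).map ι : (rationalSeries (Fin n) K)[X]),
      ⟨(MvPolynomial.finSuccEquiv K n P).map ι, q, hq0, ?_⟩, ?_⟩
    · rw [← hc, Units.mul_inv_cancel_left]
    · rw [map_mul, hι, ← hPQ, ← hι Q, ← hq, ← hc, ← mul_assoc, ← map_mul, Units.inv_mul, map_one,
        one_mul]
  · rintro ⟨f, ⟨p, q, hq, hpq⟩, rfl⟩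
    refine IsRationalSeries.of_mul (isRationalSeries_ofSlices_coe q) ?_ ?_
    · rw [← MvPowerSeries.coeff_zero_eq_constantCoeff_apply, ← Finsupp.cons_zero_zero,
        coeff_cons_ofSlices, Polynomial.coeff_coe, MvPowerSeries.coeff_zero_eq_constantCoeff_apply]
      exact isUnit_rationalSeries_iff.1 hq
    · rw [← map_mul, hpq]
      exact isRationalSeries_ofSlices_coe p

end Slices

/-! ### Diagonals, Hadamard products and the filtration -/

section Diagonal

variable {K : Type*} [Field K]

/-- The multi-index `(i, …, i)`. -/
noncomputable def constIndex (n i : ℕ) : Fin n →₀ ℕ :=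
  Finsupp.equivFunOnFinite.symm fun _ => i

theorem constIndex_apply (n i : ℕ) (j : Fin n) : constIndex n i j = i := rfl

theorem constIndex_succ (n i : ℕ) : constIndex (n + 1) i = (constIndex n i).cons i := by
  ext j
  refine Fin.cases ?_ (fun j => ?_) j
  · rw [Finsupp.cons_zero, constIndex_apply]
  · rw [Finsupp.cons_succ, constIndex_apply, constIndex_apply]

theorem constIndex_add (m n i : ℕ) :
    constIndex (m + n) i = (constIndex m i).embDomain (Fin.castAddEmb n) +
      (constIndex n i).embDomain (Fin.natAddEmb m) := by
  ext j
  rw [Finsupp.add_apply, constIndex_apply]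
  refine Fin.addCases (fun j => ?_) (fun j => ?_) j
  · rw [Finsupp.embDomain_of_notMem_range (Fin.natAddEmb m)]
    · exact (Finsupp.embDomain_apply_self (Fin.castAddEmb n) (constIndex m i) j).symm
    · rintro ⟨k, hk⟩
      simp [Fin.ext_iff] at hk
      omega
  · rw [Finsupp.embDomain_of_notMem_range (Fin.castAddEmb n), zero_add]
    · exact (Finsupp.embDomain_apply_self (Fin.natAddEmb m) (constIndex n i) j).symm
    · rintro ⟨k, hk⟩
      simp [Fin.ext_iff] at hk
      omega

theorem coeff_diagonal (n i : ℕ) (h : MvPowerSeries (Fin (n + 1)) K) :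
    PowerSeries.coeff i (diagonal n h) = MvPowerSeries.coeff (constIndex (n + 1) i) h := by
  rw [diagonal, PowerSeries.coeff_mk, constIndex]

theorem coeff_diagonal_ofSlices (n i : ℕ) (f : (rationalSeries (Fin n) K)⟦X⟧) :
    PowerSeries.coeff i (diagonal n (ofSlices K n f)) =
      MvPowerSeries.coeff (constIndex n i)
        ((PowerSeries.coeff i f : rationalSeries (Fin n) K) : MvPowerSeries (Fin n) K) := by
  rw [coeff_diagonal, constIndex_succ, coeff_cons_ofSlices]

/-- The Hadamard product of diagonals in `m + 1` and `n + 1` variables is a diagonal in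
`m + n + 1` variables: take the Hadamard product with respect to one shared variable. -/
theorem IsDiagonal.hadamard {m n : ℕ} {f g : K⟦X⟧} (hf : IsDiagonal m f) (hg : IsDiagonal n g) :
    IsDiagonal (m + n) (hadamard f g) := by
  obtain ⟨h₁, hh₁, rfl⟩ := hf
  obtain ⟨h₂, hh₂, rfl⟩ := hg
  obtain ⟨s, hs, rfl⟩ := isRationalSeries_iff_exists_slices.1 hh₁
  obtain ⟨t, ht, rfl⟩ := isRationalSeries_iff_exists_slices.1 hh₂
  -- Both coefficient rings embed into the rational series in `m + n` variables, on disjoint blocks.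
  have hst := (hs.map (renameRational K (Fin.castAddEmb n))).hadamard
    (ht.map (renameRational K (Fin.natAddEmb m)))
  refine ⟨_, isRationalSeries_iff_exists_slices.2 ⟨_, hst, rfl⟩, ?_⟩
  ext i
  rw [coeff_diagonal_ofSlices, PowerSeries.coeff_mk, PowerSeries.coeff_map, PowerSeries.coeff_map,
    MulMemClass.coe_mul, coe_renameRational, coe_renameRational, constIndex_add,
    coeff_rename_mul_rename, DiagonalGrade.hadamard, PowerSeries.coeff_mk, coeff_diagonal_ofSlices,
    coeff_diagonal_ofSlices]
  intro j k h
  simp [Fin.ext_iff] at h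
  omega

/-- The series `∑ xᵐ` over all multi-indices `m`. -/
def geomSeries (n : ℕ) (K : Type*) [Field K] : MvPowerSeries (Fin n) K := fun _ => 1

theorem coeff_geomSeries (n : ℕ) (m : Fin n →₀ ℕ) :
    MvPowerSeries.coeff m (geomSeries n K) = 1 := rfl

theorem isRationalSeries_geomSeries (n : ℕ) : IsRationalSeries (geomSeries n K) := by
  induction n with
  | zero =>
    refine ⟨1, 1, by simp, ?_⟩
    ext m
    rw [Subsingleton.elim m 0, MvPolynomial.coe_one, one_mul, MvPowerSeries.coeff_zero_one,
      coeff_geomSeries]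
  | succ n ih =>
    -- Every slice is the geometric series in `n` variables, and a constant sequence is killed by `X
    -- - 1`.
    refine isRationalSeries_iff_exists_slices.2
      ⟨PowerSeries.mk fun _ => ⟨_, ih⟩, isRational_mk_const _, ?_⟩
    ext m
    rw [← Finsupp.cons_tail m, coeff_cons_ofSlices, PowerSeries.coeff_mk, coeff_geomSeries,
      coeff_geomSeries]

theorem isDiagonal_mk_one (n : ℕ) : IsDiagonal n (PowerSeries.mk fun _ => 1 : K⟦X⟧) := by
  refine ⟨_, isRationalSeries_geomSeries (n + 1), ?_⟩
  ext i
  rw [coeff_diagonal, PowerSeries.coeff_mk, coeff_geomSeries]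

/-- The Hadamard unit is a diagonal in any number of variables; multiplying by it adds variables
without changing `f`. -/
theorem IsDiagonal.mono {m n : ℕ} (hmn : m ≤ n) {f : K⟦X⟧} (hf : IsDiagonal m f) :
    IsDiagonal n f := by
  have h := hf.hadamard (isDiagonal_mk_one (n - m))
  have hf1 : DiagonalGrade.hadamard f (PowerSeries.mk fun _ => 1) = f := by
    ext i
    rw [DiagonalGrade.hadamard, PowerSeries.coeff_mk, PowerSeries.coeff_mk, mul_one]
  rwa [Nat.add_sub_cancel' hmn, hf1] at h

theorem IsDiagonal.add {n : ℕ} {f g : K⟦X⟧} (hf : IsDiagonal n f) (hg : IsDiagonal n g) :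
    IsDiagonal n (f + g) := by
  obtain ⟨h₁, hh₁, rfl⟩ := hf
  obtain ⟨h₂, hh₂, rfl⟩ := hg
  refine ⟨h₁ + h₂, (rationalSeries _ K).add_mem hh₁ hh₂, ?_⟩
  ext i
  rw [map_add, coeff_diagonal, coeff_diagonal, coeff_diagonal, map_add]

theorem IsDiagonal.smul {n : ℕ} {f : K⟦X⟧} (c : K) (hf : IsDiagonal n f) :
    IsDiagonal n (c • f) := by
  obtain ⟨h, hh, rfl⟩ := hf
  refine ⟨c • h, (rationalSeries _ K).smul_mem hh c, ?_⟩
  ext i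
  rw [map_smul, coeff_diagonal, coeff_diagonal, map_smul]

theorem isDiagonal_zero (n : ℕ) : IsDiagonal n (0 : K⟦X⟧) := by
  have h := (isDiagonal_mk_one (K := K) n).smul 0
  rwa [zero_smul] at h

theorem mem_diagonalsLE_iff {k : ℕ} {f : K⟦X⟧} : f ∈ diagonalsLE K k ↔ IsDiagonal k f := by
  constructor
  · intro hf
    by_contra hk
    -- By monotonicity, failure at `k` forces failure at every smaller index.
    have h : ((k + 1 : ℕ) : ℕ∞) ≤ dg f := le_iInf₂ fun n hn => by
      rw [Nat.cast_le, Nat.succ_le_iff]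
      by_contra hnk
      exact hk (hn.mono (not_lt.1 hnk))
    have := h.trans hf
    rw [Nat.cast_le] at this
    omega
  · intro hf
    change dg f ≤ k
    exact iInf₂_le k hf

theorem mem_diagonals_iff {f : K⟦X⟧} : f ∈ diagonals K ↔ ∃ k, IsDiagonal k f := by
  constructor
  · intro hf
    obtain ⟨k, hk⟩ := ENat.ne_top_iff_exists.1 (ne_of_lt hf)
    exact ⟨k, mem_diagonalsLE_iff.1 hk.ge⟩
  · rintro ⟨k, hk⟩
    exact (mem_diagonalsLE_iff.2 hk : dg f ≤ k).trans_lt (ENat.natCast_lt_top k)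

/-- The algebra of diagonals under the Hadamard product. -/
def diagonalSubalgebra (K : Type*) [Field K] : Subalgebra K (HadamardSeries K) where
  carrier := {a | ∃ k, IsDiagonal k (HadamardSeries.of.symm a)}
  mul_mem' := by
    rintro a b ⟨k, hk⟩ ⟨l, hl⟩
    exact ⟨k + l, hk.hadamard hl⟩
  add_mem' := by
    rintro a b ⟨k, hk⟩ ⟨l, hl⟩
    exact ⟨max k l, (hk.mono (le_max_left k l)).add (hl.mono (le_max_right k l))⟩
  algebraMap_mem' r := by
    rw [Algebra.algebraMap_eq_smul_one]
    exact ⟨0, (isDiagonal_mk_one 0).smul r⟩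

/-- The diagonals in `k + 1` variables, as a subspace of the algebra of diagonals. -/
def diagonalFiltration (K : Type*) [Field K] (k : ℕ) : Submodule K (diagonalSubalgebra K) where
  carrier := {a | IsDiagonal k (HadamardSeries.of.symm (a : HadamardSeries K))}
  add_mem' ha hb := ha.add hb
  zero_mem' := isDiagonal_zero k
  smul_mem' c _ ha := ha.smul c

theorem isRingFiltration_diagonalFiltration (K : Type*) [Field K] :
    IsRingFiltration (diagonalFiltration K) (fun k => ⨆ j < k, diagonalFiltration K j) where
  mono _ _ hkl _ ha := IsDiagonal.mono hkl ha
  is_le {i _} hij := le_iSup₂_of_le i hij le_rfl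
  is_sup _ _ h := iSup₂_le h
  one_mem := isDiagonal_mk_one 0
  mul_mem _ _ _ _ ha hb := IsDiagonal.hadamard ha hb

end Diagonal

end DiagonalGrade

theorem propositionp (K : Type*) [Field K] [NumberField K] :
    (∀ k₁ k₂ : ℕ,
      Set.image2 DiagonalGrade.hadamard
          (DiagonalGrade.diagonalsLE K k₁) (DiagonalGrade.diagonalsLE K k₂) ⊆
        DiagonalGrade.diagonalsLE K (k₁ + k₂)) ∧
    ∃ (A : Subalgebra K (DiagonalGrade.HadamardSeries K)) (F : ℕ → Submodule K A),
      (∀ a : DiagonalGrade.HadamardSeries K,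
        a ∈ A ↔ DiagonalGrade.HadamardSeries.of.symm a ∈ DiagonalGrade.diagonals K) ∧
      (∀ (k : ℕ) (a : A),
        a ∈ F k ↔ DiagonalGrade.HadamardSeries.of.symm (a : DiagonalGrade.HadamardSeries K) ∈
          DiagonalGrade.diagonalsLE K k) ∧
      IsRingFiltration F (fun k => ⨆ j < k, F j) ∧
      (∀ a : A, ∃ k, a ∈ F k) := by
  refine ⟨?_, DiagonalGrade.diagonalSubalgebra K, DiagonalGrade.diagonalFiltration K,
    fun a => DiagonalGrade.mem_diagonals_iff.symm,
    fun k a => DiagonalGrade.mem_diagonalsLE_iff.symm,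
    DiagonalGrade.isRingFiltration_diagonalFiltration K, fun a => a.2⟩
  rintro k₁ k₂ _ ⟨f, hf, g, hg, rfl⟩
  rw [DiagonalGrade.mem_diagonalsLE_iff] at *
  exact hf.hadamard hg
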